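/- For $\alpha,\beta\in\mathbb{R}$ let $\Phi_{\alpha,\beta}(\rho)=A_1\rho A_1^*+A_2\rho A_2^*$ be the qubit channel on $2\times 2$ complex matrices with Kraus operators $$A_1=\begin{pmatrix}\cos\alpha&0\\0&\cos\beta\end{pmatrix},\qquad A_2=\begin{pmatrix}0&\sin\beta\\\sin\alpha&0\end{pmatrix},$$ and suppose that its Choi matrix $\sum_{i,j}E_{ij}\otimes\Phi_{\alpha,\beta}(E_{ij})$ has rank $2$. Then $\Phi_{\alpha,\beta}$ is degradable if and only if $\cos(2\alpha)\cos(2\beta)\ge 0$. Here a quantum channel is a completely positive trace-preserving linear map between complex matrix algebras. Channels $\Phi$ from $\mathcal{L}(\mathcal{X})$ to $\mathcal{L}(\mathcal{Y})$ and $\widetilde\Phi$ from $\mathcal{L}(\mathcal{X})$ to $\mathcal{L}(\mathcal{Z})$, with $\mathcal{X},\mathcal{Y},\mathcal{Z}$ finite-dimensional, are complementary if there is an isometry $V:\mathcal{X}\to\mathcal{Y}\otimes\mathcal{Z}$ with $\Phi(\rho)=\operatorname{tr}_{\mathcal{Z}}(V\rho V^*)$ and $\widetilde\Phi(\rho)=\operatorname{tr}_{\mathcal{Y}}(V\rho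 V^*)$ for all $\rho$; and $\Phi$ is degradable if there are a channel $\widetilde\Phi$ complementary to $\Phi$ and a channel $\Gamma$ with $\widetilde\Phi=\Gamma\circ\Phi$. -/

import Mathlib

open Matrix

noncomputable section

namespace QubitChannel

open scoped ComplexOrder

/-- `id_k ⊗ Φ`, acting on `k × k` block matrices by applying `Φ` to every block. -/
def ampliation {X Y : Type} (k : ℕ)
    (Φ : Matrix X X ℂ →ₗ[ℂ] Matrix Y Y ℂ) (M : Matrix (Fin k × X) (Fin k × X) ℂ) :
    Matrix (Fin k × Y) (Fin k × Y) ℂ :=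
  Matrix.of fun p q => Φ (Matrix.of fun i j => M (p.1, i) (q.1, j)) p.2 q.2

/-- Complete positivity: `id_k ⊗ Φ` preserves positive semidefiniteness for every `k`. -/
def IsCompletelyPositive {X Y : Type}
    (Φ : Matrix X X ℂ →ₗ[ℂ] Matrix Y Y ℂ) : Prop :=
  ∀ (k : ℕ) (M : Matrix (Fin k × X) (Fin k × X) ℂ), M.PosSemidef → (ampliation k Φ M).PosSemidef

/-- A quantum channel: a completely positive trace-preserving linear map. -/
structure IsChannel {X Y : Type} [Fintype X] [Fintype Y]
    (Φ : Matrix X X ℂ →ₗ[ℂ] Matrix Y Y ℂ) : Prop where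
  completelyPositive : IsCompletelyPositive Φ
  trace_preserving : ∀ ρ, (Φ ρ).trace = ρ.trace

/-- The partial trace over the second tensor factor. -/
def traceSnd {Y Z : Type} [Fintype Z] (M : Matrix (Y × Z) (Y × Z) ℂ) : Matrix Y Y ℂ :=
  Matrix.of fun i j => ∑ z, M (i, z) (j, z)

/-- The partial trace over the first tensor factor. -/
def traceFst {Y Z : Type} [Fintype Y] (M : Matrix (Y × Z) (Y × Z) ℂ) : Matrix Z Z ℂ :=
  Matrix.of fun i j => ∑ y, M (y, i) (y, j)

/-- `Φ` and `Ψ` are complementary: the two marginals of one isometry `V : X → Y ⊗ Z`. -/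
def IsComplementary {X Y Z : Type} [Fintype X] [DecidableEq X] [Fintype Y] [Fintype Z]
    (Φ : Matrix X X ℂ →ₗ[ℂ] Matrix Y Y ℂ) (Ψ : Matrix X X ℂ →ₗ[ℂ] Matrix Z Z ℂ) : Prop :=
  ∃ V : Matrix (Y × Z) X ℂ, Vᴴ * V = 1 ∧
    (∀ ρ, Φ ρ = traceSnd (V * ρ * Vᴴ)) ∧ (∀ ρ, Ψ ρ = traceFst (V * ρ * Vᴴ))

/-- `Φ` is degradable: a complementary channel of `Φ` (with some environment `ℂ^d`) equals
`Γ ∘ Φ` for some quantum channel `Γ`. -/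
def IsDegradable {X Y : Type} [Fintype X] [DecidableEq X] [Fintype Y]
    (Φ : Matrix X X ℂ →ₗ[ℂ] Matrix Y Y ℂ) : Prop :=
  ∃ (d : ℕ) (Ψ : Matrix X X ℂ →ₗ[ℂ] Matrix (Fin d) (Fin d) ℂ)
    (Γ : Matrix Y Y ℂ →ₗ[ℂ] Matrix (Fin d) (Fin d) ℂ),
    IsComplementary Φ Ψ ∧ IsChannel Γ ∧ Ψ = Γ ∘ₗ Φ

/-- The Choi matrix `∑ i j, E_{ij} ⊗ Φ(E_{ij})`. -/
def choiMatrix {X Y : Type} [DecidableEq X]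
    (Φ : Matrix X X ℂ →ₗ[ℂ] Matrix Y Y ℂ) : Matrix (X × Y) (X × Y) ℂ :=
  Matrix.of fun p q => Φ (Matrix.single p.1 q.1 1) p.2 q.2

/-- The linear map `ρ ↦ ∑ i, K i * ρ * (K i)ᴴ` with Kraus operators `K i`. -/
def krausMap {X Y ι : Type} [Fintype X] [Fintype ι] (K : ι → Matrix Y X ℂ) :
    Matrix X X ℂ →ₗ[ℂ] Matrix Y Y ℂ where
  toFun ρ := ∑ i, K i * ρ * (K i)ᴴ
  map_add' ρ σ := by simp [Matrix.mul_add, Matrix.add_mul, Finset.sum_add_distrib]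
  map_smul' c ρ := by simp [Finset.smul_sum]

/-- The two Kraus operators with angles `α` and `β`. -/
def qubitKraus (α β : ℝ) : Fin 2 → Matrix (Fin 2) (Fin 2) ℂ :=
  ![!![(Real.cos α : ℂ), 0; 0, (Real.cos β : ℂ)],
    !![0, (Real.sin β : ℂ); (Real.sin α : ℂ), 0]]

end QubitChannel

end

noncomputable section

namespace QubitChannel

open scoped ComplexOrder Kronecker

/-! ### Kraus maps and complete positivity -/

/-! Write `a, s` and `b, t` for the cosine and sine of `α` and `β`, and `C = a² - s²`, `D = b² -
t²`. If `C * D ≥ 0`, a degrading map is sought of the same diagonal/antidiagonal shape; its trace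
preservation is a linear system in two squared scale factors, solved by `2C/(C+D)` and `2D/(C+D)`,
which are nonnegative (`isDegradable_diagAntidiag_of_nonneg`). Conversely, degradability makes the
weight of each Kraus operator a positive functional of the channel output
(`IsDegradable.exists_positive_functional`). On diagonal inputs this gives two 2×2 linear systems
with nonnegative solutions; Cramer's rule then writes `C` and `D` as the same `δ` times nonnegative
numbers, so `C * D ≥ 0`. -/

theorem krausMap_apply {X Y ι : Type} [Fintype X] [Fintype ι] (K : ι → Matrix Y X ℂ)
    (ρ : Matrix X X ℂ) : krausMap K ρ = ∑ i, K i * ρ * (K i)ᴴ := rfl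

theorem ampliation_krausMap {X Y ι : Type} [Fintype X] [Fintype ι] (K : ι → Matrix Y X ℂ)
    (k : ℕ) (M : Matrix (Fin k × X) (Fin k × X) ℂ) :
    ampliation k (krausMap K) M =
      ∑ i, ((1 : Matrix (Fin k) (Fin k) ℂ) ⊗ₖ K i) * M *
        ((1 : Matrix (Fin k) (Fin k) ℂ) ⊗ₖ K i)ᴴ := by
  ext ⟨p, y⟩ ⟨q, y'⟩
  simp only [ampliation, krausMap_apply, Matrix.of_apply, Matrix.sum_apply]
  refine Finset.sum_congr rfl fun i _ => ?_
  simp [Matrix.mul_apply, Fintype.sum_prod_type, Matrix.one_apply, apply_ite]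

theorem isCompletelyPositive_krausMap {X Y ι : Type} [Fintype X] [Fintype Y] [Fintype ι]
    (K : ι → Matrix Y X ℂ) : IsCompletelyPositive (krausMap K) := by
  intro k M hM
  rw [ampliation_krausMap]
  exact Matrix.posSemidef_sum _ fun i _ => hM.mul_mul_conjTranspose_same _

theorem isChannel_krausMap {X Y ι : Type} [Fintype X] [DecidableEq X] [Fintype Y] [Fintype ι]
    (K : ι → Matrix Y X ℂ) (hK : ∑ i, (K i)ᴴ * K i = 1) : IsChannel (krausMap K) where
  completelyPositive := isCompletelyPositive_krausMap K
  trace_preserving ρ := by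
    rw [krausMap_apply, Matrix.trace_sum]
    calc ∑ i, (K i * ρ * (K i)ᴴ).trace = ∑ i, ((K i)ᴴ * K i * ρ).trace :=
          Finset.sum_congr rfl fun i _ => by rw [Matrix.trace_mul_comm, Matrix.mul_assoc]
      _ = ρ.trace := by rw [← Matrix.trace_sum, ← Matrix.sum_mul, hK, Matrix.one_mul]

theorem IsCompletelyPositive.posSemidef_apply {X Y : Type}
    {Φ : Matrix X X ℂ →ₗ[ℂ] Matrix Y Y ℂ} (hΦ : IsCompletelyPositive Φ)
    {ρ : Matrix X X ℂ} (hρ : ρ.PosSemidef) : (Φ ρ).PosSemidef :=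
  (hΦ 1 (ρ.submatrix Prod.snd Prod.snd) (hρ.submatrix _)).submatrix fun y => ((0 : Fin 1), y)

/-! ### Complementary channels -/

/-- The Stinespring operator `∑ i, K i ⊗ e i` of a family of Kraus operators. -/
def stinespring {X Y ι : Type} (K : ι → Matrix Y X ℂ) : Matrix (Y × ι) X ℂ :=
  Matrix.of fun p x => K p.2 p.1 x

/-- The complement of a Kraus map: `ρ ↦ ∑ i j, tr (K i * ρ * (K j)ᴴ) E_{ij}`. -/
def complementMap {X Y ι : Type} [Fintype X] [Fintype Y] (K : ι → Matrix Y X ℂ) :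
    Matrix X X ℂ →ₗ[ℂ] Matrix ι ι ℂ where
  toFun ρ := Matrix.of fun i j => (K i * ρ * (K j)ᴴ).trace
  map_add' ρ σ := by ext; simp [Matrix.mul_add, Matrix.add_mul]
  map_smul' c ρ := by ext; simp

theorem complementMap_apply {X Y ι : Type} [Fintype X] [Fintype Y] (K : ι → Matrix Y X ℂ)
    (ρ : Matrix X X ℂ) (i j : ι) : complementMap K ρ i j = (K i * ρ * (K j)ᴴ).trace := rfl

theorem traceSnd_stinespring {X Y ι : Type} [Fintype X] [Fintype ι]
    (K : ι → Matrix Y X ℂ) (ρ : Matrix X X ℂ) :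
    traceSnd (stinespring K * ρ * (stinespring K)ᴴ) = krausMap K ρ := by
  ext y y'
  simp [traceSnd, stinespring, krausMap_apply, Matrix.sum_apply, Matrix.mul_apply]

theorem traceFst_stinespring {X Y ι : Type} [Fintype X] [Fintype Y]
    (K : ι → Matrix Y X ℂ) (ρ : Matrix X X ℂ) :
    traceFst (stinespring K * ρ * (stinespring K)ᴴ) = complementMap K ρ := by
  ext i j
  simp [traceFst, stinespring, complementMap_apply, Matrix.trace, Matrix.mul_apply]

theorem conjTranspose_stinespring_mul_self {X Y ι : Type} [Fintype Y] [Fintype ι]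
    (K : ι → Matrix Y X ℂ) :
    (stinespring K)ᴴ * stinespring K = ∑ i, (K i)ᴴ * K i := by
  ext x x'
  simp only [stinespring, Matrix.mul_apply, Matrix.conjTranspose_apply, Matrix.of_apply,
    Matrix.sum_apply, Fintype.sum_prod_type]
  exact Finset.sum_comm

theorem isComplementary_complementMap {X Y ι : Type} [Fintype X] [DecidableEq X] [Fintype Y]
    [Fintype ι] (K : ι → Matrix Y X ℂ) (hK : ∑ i, (K i)ᴴ * K i = 1) :
    IsComplementary (krausMap K) (complementMap K) :=
  ⟨stinespring K, (conjTranspose_stinespring_mul_self K).trans hK,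
    fun ρ => (traceSnd_stinespring K ρ).symm, fun ρ => (traceFst_stinespring K ρ).symm⟩

theorem krausMap_single_apply {X Y ι : Type} [Fintype X] [DecidableEq X] [Fintype ι]
    (K : ι → Matrix Y X ℂ) (x x' : X) (y y' : Y) :
    krausMap K (Matrix.single x x' 1) y y' = ∑ i, K i y x * star (K i y' x') := by
  simp only [krausMap_apply, Matrix.sum_apply]
  refine Finset.sum_congr rfl fun i _ => ?_
  simp [Matrix.mul_apply, Matrix.single_apply, ite_and]

/-- If two Kraus families give the same map and `K k` is nonzero and Hilbert–Schmidt orthogonal to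
the other members of its family, then `K k` is a linear combination of the other family. -/
theorem exists_eq_sum_smul_of_krausMap_eq {X Y ι κ : Type} [Fintype X] [DecidableEq X] [Fintype Y]
    [Fintype ι] [Fintype κ] {K : ι → Matrix Y X ℂ} {B : κ → Matrix Y X ℂ}
    (h : krausMap K = krausMap B) (k : ι)
    (horth : ∀ i, i ≠ k → ∑ y, ∑ x, star (K i y x) * K k y x = 0)
    (hk : ∑ y, ∑ x, star (K k y x) * K k y x ≠ 0) :
    ∃ v : κ → ℂ, K k = ∑ z, v z • B z := by
  set n := ∑ y, ∑ x, star (K k y x) * K k y x with hn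
  -- Both families give one Choi matrix, the sum of the rank-one projectors onto their
  -- vectorizations. By orthogonality it sends `K k` to `n • K k`; expanding that image in the `B z`
  -- gives these coefficients.
  refine ⟨fun z => n⁻¹ * ∑ y, ∑ x, star (B z y x) * K k y x, ?_⟩
  have key : ∀ x x' y y', ∑ z, B z y x * star (B z y' x') = ∑ i, K i y x * star (K i y' x') :=
    fun x x' y y' => by rw [← krausMap_single_apply, ← krausMap_single_apply, h]
  ext y x
  have h1 : (∑ z, (∑ y', ∑ x', star (B z y' x') * K k y' x') * B z y x) =
      ∑ i, (∑ y', ∑ x', star (K i y' x') * K k y' x') * K i y x := by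
    calc _ = ∑ y', ∑ x', (∑ z, B z y x * star (B z y' x')) * K k y' x' := by
          simp only [Finset.sum_mul]
          rw [Finset.sum_comm]
          refine Finset.sum_congr rfl fun y' _ => ?_
          rw [Finset.sum_comm]
          exact Finset.sum_congr rfl fun x' _ => Finset.sum_congr rfl fun z _ => by ring
      _ = ∑ y', ∑ x', (∑ i, K i y x * star (K i y' x')) * K k y' x' := by simp only [key]
      _ = _ := by
          simp only [Finset.sum_mul]
          symm
          rw [Finset.sum_comm]
          refine Finset.sum_congr rfl fun y' _ => ?_
          rw [Finset.sum_comm]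
          exact Finset.sum_congr rfl fun x' _ => Finset.sum_congr rfl fun z _ => by ring
  rw [Finset.sum_eq_single k (fun i _ hi => by rw [horth i hi, zero_mul]) (by simp), ← hn] at h1
  simp only [Matrix.sum_apply, Matrix.smul_apply, smul_eq_mul, mul_assoc]
  rw [← Finset.mul_sum, h1, inv_mul_cancel_left₀ hk]

/-- Compressing a complement to a vector of the environment gives the weight of a combination of
Kraus operators. -/
theorem dotProduct_complementMap {X Y κ : Type} [Fintype X] [Fintype Y] [Fintype κ]
    (B : κ → Matrix Y X ℂ) (v : κ → ℂ) (ρ : Matrix X X ℂ) :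
    v ⬝ᵥ (complementMap B ρ *ᵥ star v) =
      ((∑ z, v z • B z) * ρ * (∑ z, v z • B z)ᴴ).trace := by
  simp only [dotProduct, mulVec, complementMap_apply, Matrix.conjTranspose_sum, Matrix.sum_mul,
    Matrix.mul_sum, Matrix.trace_sum, Matrix.conjTranspose_smul, Matrix.smul_mul, Matrix.mul_smul,
    Matrix.trace_smul, smul_eq_mul, Finset.mul_sum, Pi.star_apply]
  rw [Finset.sum_comm]
  exact Finset.sum_congr rfl fun i _ => Finset.sum_congr rfl fun j _ => by ring

/-- If `krausMap K` is degradable, each weight `ρ ↦ tr (K k * ρ * (K k)ᴴ)` of a Kraus operator that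
is nonzero and orthogonal to the others is a positive linear functional of `krausMap K ρ`. -/
theorem IsDegradable.exists_positive_functional {X Y ι : Type} [Fintype X] [DecidableEq X]
    [Fintype Y] [Fintype ι] {K : ι → Matrix Y X ℂ} (h : IsDegradable (krausMap K)) (k : ι)
    (horth : ∀ i, i ≠ k → ∑ y, ∑ x, star (K i y x) * K k y x = 0)
    (hk : ∑ y, ∑ x, star (K k y x) * K k y x ≠ 0) :
    ∃ φ : Matrix Y Y ℂ →ₗ[ℂ] ℂ, (∀ σ, σ.PosSemidef → 0 ≤ φ σ) ∧
      ∀ ρ, φ (krausMap K ρ) = (K k * ρ * (K k)ᴴ).trace := by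
  obtain ⟨d, Ψ, Γ, ⟨V, -, hΦ, hΨ⟩, hΓ, hcomp⟩ := h
  -- The slices of `V` along the environment are Kraus operators for the same channel.
  let B : Fin d → Matrix Y X ℂ := fun z => Matrix.of fun y x => V (y, z) x
  have hV : V = stinespring B := rfl
  obtain ⟨v, hv⟩ := exists_eq_sum_smul_of_krausMap_eq (B := B)
    (LinearMap.ext fun ρ => by rw [hΦ, hV, traceSnd_stinespring]) k horth hk
  refine ⟨{ toFun := fun σ => v ⬝ᵥ (Γ σ *ᵥ star v)
            map_add' := fun σ τ => by simp [Matrix.add_mulVec]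
            map_smul' := fun c σ => by simp [Matrix.smul_mulVec] }, fun σ hσ => ?_, fun ρ => ?_⟩
  · simpa using (hΓ.completelyPositive.posSemidef_apply hσ).dotProduct_mulVec_nonneg (star v)
  · have : Γ (krausMap K ρ) = complementMap B ρ := by
      rw [← traceFst_stinespring, ← hV, ← hΨ, hcomp, LinearMap.comp_apply]
    simp only [LinearMap.coe_mk, AddHom.coe_mk]
    rw [this, dotProduct_complementMap, ← hv]

/-! ### The two-parameter family of qubit channels -/

/-- A pair of a diagonal and an antidiagonal Kraus operator with real entries. -/
def diagAntidiag (a b s t : ℝ) : Fin 2 → Matrix (Fin 2) (Fin 2) ℂ :=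
  ![!![(a : ℂ), 0; 0, (b : ℂ)], !![0, (t : ℂ); (s : ℂ), 0]]

theorem sum_conjTranspose_mul_diagAntidiag {a b s t : ℝ} (h₀ : a ^ 2 + s ^ 2 = 1)
    (h₁ : b ^ 2 + t ^ 2 = 1) :
    ∑ i, (diagAntidiag a b s t i)ᴴ * diagAntidiag a b s t i = 1 := by
  have h₀' : (a : ℂ) * a + s * s = 1 := by exact_mod_cast (by linarith : a * a + s * s = 1)
  have h₁' : (b : ℂ) * b + t * t = 1 := by exact_mod_cast (by linarith : b * b + t * t = 1)
  ext i j
  fin_cases i <;> fin_cases j <;>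
    simp [diagAntidiag, Fin.sum_univ_two, Matrix.mul_apply, h₀', h₁']

theorem krausMap_diagAntidiag (a b s t : ℝ) (ρ : Matrix (Fin 2) (Fin 2) ℂ) :
    krausMap (diagAntidiag a b s t) ρ =
      !![(a : ℂ) ^ 2 * ρ 0 0 + t ^ 2 * ρ 1 1, a * b * ρ 0 1 + s * t * ρ 1 0;
         (a : ℂ) * b * ρ 1 0 + s * t * ρ 0 1, b ^ 2 * ρ 1 1 + s ^ 2 * ρ 0 0] := by
  ext i j
  fin_cases i <;> fin_cases j <;>
    simp [diagAntidiag, krausMap_apply, Fin.sum_univ_two, Matrix.vecMul, dotProduct,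
      Matrix.mul_apply] <;> ring

theorem complementMap_diagAntidiag (a b s t : ℝ) (ρ : Matrix (Fin 2) (Fin 2) ℂ) :
    complementMap (diagAntidiag a b s t) ρ =
      !![(a : ℂ) ^ 2 * ρ 0 0 + b ^ 2 * ρ 1 1, a * t * ρ 0 1 + b * s * ρ 1 0;
         (a : ℂ) * t * ρ 1 0 + b * s * ρ 0 1, t ^ 2 * ρ 1 1 + s ^ 2 * ρ 0 0] := by
  ext i j
  fin_cases i <;> fin_cases j <;>
    simp [diagAntidiag, complementMap_apply, Matrix.trace, Fin.sum_univ_two,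
      Matrix.vecMul, dotProduct, Matrix.mul_apply] <;> ring

/-- The degrading map is `krausMap (diagAntidiag (κ * b) (κ * t) (l * s) (l * a))`. -/
theorem isDegradable_diagAntidiag {a b s t κ l : ℝ} (h₀ : a ^ 2 + s ^ 2 = 1)
    (h₁ : b ^ 2 + t ^ 2 = 1) (g₀ : (κ * b) ^ 2 + (l * s) ^ 2 = 1)
    (g₁ : (κ * t) ^ 2 + (l * a) ^ 2 = 1) :
    IsDegradable (krausMap (diagAntidiag a b s t)) := by
  refine ⟨2, complementMap (diagAntidiag a b s t),
    krausMap (diagAntidiag (κ * b) (κ * t) (l * s) (l * a)),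
    isComplementary_complementMap _ (sum_conjTranspose_mul_diagAntidiag h₀ h₁),
    isChannel_krausMap _ (sum_conjTranspose_mul_diagAntidiag g₀ g₁), LinearMap.ext fun ρ => ?_⟩
  have g₀' : ((κ : ℂ) * b) ^ 2 + (l * s) ^ 2 = 1 := by exact_mod_cast g₀
  have g₁' : ((κ : ℂ) * t) ^ 2 + (l * a) ^ 2 = 1 := by exact_mod_cast g₁
  rw [LinearMap.comp_apply, complementMap_diagAntidiag, krausMap_diagAntidiag,
    krausMap_diagAntidiag]
  ext i j
  fin_cases i <;> fin_cases j <;> simp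
  -- In every entry, the two terms of the composite are those of the complement times the left sides
  -- of `g₀'` and `g₁'`.
  · linear_combination (-(a : ℂ) ^ 2 * ρ 0 0) * g₀' - (b : ℂ) ^ 2 * ρ 1 1 * g₁'
  · linear_combination (-(a : ℂ) * t * ρ 0 1) * g₀' - (b : ℂ) * s * ρ 1 0 * g₁'
  · linear_combination (-(a : ℂ) * t * ρ 1 0) * g₀' - (b : ℂ) * s * ρ 0 1 * g₁'
  · linear_combination (-(t : ℂ) ^ 2 * ρ 1 1) * g₀' - (s : ℂ) ^ 2 * ρ 0 0 * g₁'

theorem isDegradable_diagAntidiag_of_nonneg {a b s t : ℝ} (h₀ : a ^ 2 + s ^ 2 = 1)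
    (h₁ : b ^ 2 + t ^ 2 = 1) (h : 0 ≤ (a ^ 2 - s ^ 2) * (b ^ 2 - t ^ 2)) :
    IsDegradable (krausMap (diagAntidiag a b s t)) := by
  obtain ⟨k, l, hk, hl, g₀, g₁⟩ : ∃ k l : ℝ, 0 ≤ k ∧ 0 ≤ l ∧ k * b ^ 2 + l * s ^ 2 = 1 ∧
      k * t ^ 2 + l * a ^ 2 = 1 := by
    set C := a ^ 2 - s ^ 2 with hC
    set D := b ^ 2 - t ^ 2 with hD
    by_cases hCD : C + D = 0
    -- Here `C = D = 0`, all four squares are `1/2`, and any nonnegative `k + l = 2` would do.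
    · have hC0 : C = 0 := by nlinarith [sq_nonneg C]
      exact ⟨2, 0, by norm_num, le_rfl, by linarith, by linarith⟩
    · refine ⟨2 * C / (C + D), 2 * D / (C + D), ?_, ?_, ?_, ?_⟩
      -- Making the denominator a square avoids splitting on the sign of `C + D`.
      · rw [← mul_div_mul_right _ _ hCD]
        exact div_nonneg (by nlinarith [sq_nonneg C]) (mul_self_nonneg _)
      · rw [← mul_div_mul_right _ _ hCD]
        exact div_nonneg (by nlinarith [sq_nonneg D]) (mul_self_nonneg _)
      · field_simp
        rw [show b ^ 2 = (1 + D) / 2 by linarith, show s ^ 2 = (1 - C) / 2 by linarith]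
        ring
      · field_simp
        rw [show t ^ 2 = (1 - D) / 2 by linarith, show a ^ 2 = (1 + C) / 2 by linarith]
        ring
  apply isDegradable_diagAntidiag (κ := √k) (l := √l) h₀ h₁
  · rw [mul_pow, mul_pow, Real.sq_sqrt hk, Real.sq_sqrt hl, g₀]
  · rw [mul_pow, mul_pow, Real.sq_sqrt hk, Real.sq_sqrt hl, g₁]

/-- The values on the two diagonal projections of a positive functional on `2 × 2` matrices,
expressed through its values on the image of the channel. -/
theorem exists_nonneg_of_functional {a b s t p q : ℝ} {φ : Matrix (Fin 2) (Fin 2) ℂ →ₗ[ℂ] ℂ}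
    (hφ : ∀ σ, σ.PosSemidef → 0 ≤ φ σ)
    (hp : φ (krausMap (diagAntidiag a b s t) (Matrix.diagonal ![1, 0])) = p)
    (hq : φ (krausMap (diagAntidiag a b s t) (Matrix.diagonal ![0, 1])) = q) :
    ∃ x y : ℝ, 0 ≤ x ∧ 0 ≤ y ∧ a ^ 2 * x + s ^ 2 * y = p ∧ t ^ 2 * x + b ^ 2 * y = q := by
  have hx := hφ (Matrix.diagonal ![1, 0])
    (Matrix.PosSemidef.diagonal fun i => by fin_cases i <;> simp)
  have hy := hφ (Matrix.diagonal ![0, 1])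
    (Matrix.PosSemidef.diagonal fun i => by fin_cases i <;> simp)
  have hdiag : ∀ x y : ℂ, φ !![x, 0; 0, y] =
      x * φ (Matrix.diagonal ![1, 0]) + y * φ (Matrix.diagonal ![0, 1]) := by
    intro x y
    rw [← smul_eq_mul, ← smul_eq_mul, ← map_smul, ← map_smul, ← map_add]
    congr 1
    ext i j
    fin_cases i <;> fin_cases j <;> simp
  obtain ⟨x, hx0, (hx : Complex.ofReal x = _)⟩ := RCLike.nonneg_iff_exists_ofReal.1 hx
  obtain ⟨y, hy0, (hy : Complex.ofReal y = _)⟩ := RCLike.nonneg_iff_exists_ofReal.1 hy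
  refine ⟨x, y, hx0, hy0, ?_, ?_⟩
  · rw [krausMap_diagAntidiag] at hp
    simp [hdiag, ← hx, ← hy] at hp
    exact_mod_cast hp
  · rw [krausMap_diagAntidiag] at hq
    simp [hdiag, ← hx, ← hy] at hq
    exact_mod_cast hq

theorem nonneg_of_isDegradable_diagAntidiag {a b s t : ℝ} (h₀ : a ^ 2 + s ^ 2 = 1)
    (h₁ : b ^ 2 + t ^ 2 = 1) (h : IsDegradable (krausMap (diagAntidiag a b s t))) :
    0 ≤ (a ^ 2 - s ^ 2) * (b ^ 2 - t ^ 2) := by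
  by_contra! hneg
  -- If either Kraus operator vanished, `C * D` would be `1`.
  have hab : a ^ 2 + b ^ 2 ≠ 0 := fun h => by nlinarith [sq_nonneg a, sq_nonneg b]
  have hst : s ^ 2 + t ^ 2 ≠ 0 := fun h => by nlinarith [sq_nonneg s, sq_nonneg t]
  obtain ⟨φ, hφ, hφK⟩ := h.exists_positive_functional 0
    (by intro i hi; fin_cases i <;> simp_all [diagAntidiag])
    (by simp [diagAntidiag]; exact_mod_cast (by simpa [sq] using hab))
  obtain ⟨ψ, hψ, hψK⟩ := h.exists_positive_functional 1
    (by intro i hi; fin_cases i <;> simp_all [diagAntidiag])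
    (by simp [diagAntidiag]; exact_mod_cast (by simpa [sq, add_comm] using hst))
  obtain ⟨x, y, hx, hy, e₁, e₂⟩ := exists_nonneg_of_functional (p := a ^ 2) (q := b ^ 2) hφ
    (by rw [hφK, ← complementMap_apply, complementMap_diagAntidiag]; simp)
    (by rw [hφK, ← complementMap_apply, complementMap_diagAntidiag]; simp)
  obtain ⟨z, w, hz, hw, e₃, e₄⟩ := exists_nonneg_of_functional (p := s ^ 2) (q := t ^ 2) hψ
    (by rw [hψK, ← complementMap_apply, complementMap_diagAntidiag]; simp)
    (by rw [hψK, ← complementMap_apply, complementMap_diagAntidiag]; simp)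
  -- The common determinant of both systems. It may vanish, so Cramer's rule is kept in undivided
  -- form.
  set δ := a ^ 2 * b ^ 2 - s ^ 2 * t ^ 2 with hδ
  have d₁ : δ * x = b ^ 2 * (a ^ 2 - s ^ 2) := by linear_combination b ^ 2 * e₁ - s ^ 2 * e₂
  have d₂ : δ * y = a ^ 2 * (b ^ 2 - t ^ 2) := by linear_combination a ^ 2 * e₂ - t ^ 2 * e₁
  have d₃ : δ * z = s ^ 2 * (b ^ 2 - t ^ 2) := by linear_combination b ^ 2 * e₃ - s ^ 2 * e₄
  have d₄ : δ * w = t ^ 2 * (a ^ 2 - s ^ 2) := by linear_combination a ^ 2 * e₄ - t ^ 2 * e₃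
  have hsumC : δ * (x + w) = a ^ 2 - s ^ 2 := by linear_combination d₁ + d₄ + (a ^ 2 - s ^ 2) * h₁
  have hsumD : δ * (y + z) = b ^ 2 - t ^ 2 := by linear_combination d₂ + d₃ + (b ^ 2 - t ^ 2) * h₀
  rw [← hsumC, ← hsumD] at hneg
  have : 0 ≤ δ ^ 2 * ((x + w) * (y + z)) := by positivity
  linarith

end QubitChannel

end

theorem mainTheorem3 (α β : ℝ)
    (hrank : (QubitChannel.choiMatrix
      (QubitChannel.krausMap (QubitChannel.qubitKraus α β))).rank = 2) :
    QubitChannel.IsDegradable (QubitChannel.krausMap (QubitChannel.qubitKraus α β)) ↔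
      0 ≤ Real.cos (2 * α) * Real.cos (2 * β) := by
  rw [Real.cos_two_mul', Real.cos_two_mul']
  exact ⟨QubitChannel.nonneg_of_isDegradable_diagAntidiag (Real.cos_sq_add_sin_sq α)
      (Real.cos_sq_add_sin_sq β),
    QubitChannel.isDegradable_diagAntidiag_of_nonneg (Real.cos_sq_add_sin_sq α)
      (Real.cos_sq_add_sin_sq β)⟩
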